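/- Let $G$ be a finite simple connected graph with $n$ vertices, $m$ edges and minimum degree $\delta(G)\ge 3$. Let $D(G)$ be the set of its $2m$ oriented edges (each edge with both orientations); for $e\in D(G)$ write $o(e)$, $t(e)$, $e^{-1}$ for its origin, its terminus and its inverse. A pair $(e,f)$ of oriented edges is a 2-step-arc if there is $g\in D(G)$ with $g\ne e^{-1}$, $g\ne f^{-1}$, $o(g)=t(e)$ and $t(g)=o(f)$; it is a 2-step-identity if $e=f$. A 2-step-cycle of length $|C|=\ell\ge 1$ is a sequence $C=(e_0,\dots,e_{\ell-1})$ of oriented edges such that, for every $i\in\mathbb{Z}/\ell\mathbb{Z}$, $(e_i,e_{i+1})$ is a 2-step-arc or a 2-step-identity. It is prime if it is not obtained by going $r$ times around a strictly shorter 2-step-cycle, for any $r$. Two 2-step-cycles are equivalent if one is a cyclic permutation of the other. The modified zeta function of $G$ is $$\tilde{\mathbf Z}_G(u)=\prod_{[C]}\bigl(1-u^{|C|}\bigr)^{-1},$$ where $[C]$ runs over the equivalence classes of prime 2-step-cycles. Then the product converges for all complex $u$ with $|u|$ sufficiently small, it has a (necessarily unique) meromorphic continuation to $\mathbb{C}$,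 again denoted $\tilde{\mathbf Z}_G$, and $u=1/2$ is a pole of $\tilde{\mathbf Z}_G$, of order exactly $$2(m-n+1)\ \text{ if } G \text{ is bipartite},\qquad 2(m-n)+1\ \text{ if } G \text{ is not bipartite}.$$ -/

import Mathlib

open Filter Topology

namespace ModifiedZeta

variable {V : Type*}

/-- The ordered pair `(e, f)` of oriented edges is a 2-step-arc: some oriented edge `g`,
different from `e⁻¹` and from `f⁻¹`, runs from the terminus of `e` to the origin of `f`. -/
def IsTwoStepArc (G : SimpleGraph V) (e f : G.Dart) : Prop :=
  ∃ g : G.Dart, g ≠ e.symm ∧ g ≠ f.symm ∧ g.fst = e.snd ∧ g.snd = f.fst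

/-- `(e, f)` is a 2-step-arc or a 2-step-identity. -/
def TwoStep (G : SimpleGraph V) (e f : G.Dart) : Prop :=
  IsTwoStepArc G e f ∨ e = f

/-- A 2-step-cycle of length `ℓ ≥ 1`: a sequence `(e₀, …, e_{ℓ-1})` of oriented edges in which
every cyclically consecutive pair `(eᵢ, eᵢ₊₁)`, `i ∈ ℤ/ℓℤ`, is a 2-step-arc or a
2-step-identity. (For `ℓ = 1` the only such pair is `(e₀, e₀)`.) -/
def IsTwoStepCycle (G : SimpleGraph V) (l : List G.Dart) : Prop :=
  l ≠ [] ∧ Cycle.Chain (TwoStep G) (l : Cycle G.Dart)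

/-- A 2-step-cycle is prime if it is not obtained by going `r` times around a strictly shorter
2-step-cycle. -/
def IsPrimeTwoStepCycle (G : SimpleGraph V) (l : List G.Dart) : Prop :=
  IsTwoStepCycle G l ∧
    ∀ (b : List G.Dart) (r : ℕ), IsTwoStepCycle G b → b.length < l.length →
      l ≠ (List.replicate r b).flatten

/-- The equivalence classes `[C]`, under cyclic permutation, of prime 2-step-cycles. (`Cycle α` is
the quotient of `List α` by cyclic permutation.) -/
def PrimeClass (G : SimpleGraph V) : Type _ :=
  {c : Cycle G.Dart // ∃ l : List G.Dart, IsPrimeTwoStepCycle G l ∧ (l : Cycle G.Dart) = c}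

/-- The factor `(1 - u ^ |C|)⁻¹` of the Euler product belonging to the class `[C]`. -/
noncomputable def eulerFactor (G : SimpleGraph V) (u : ℂ) (c : PrimeClass G) : ℂ :=
  (1 - u ^ c.1.length)⁻¹

/-- The modified zeta function of `G`, as an Euler product, for `u` near `0`. -/
noncomputable def modifiedZeta (G : SimpleGraph V) (u : ℂ) : ℂ :=
  ∏' c : PrimeClass G, eulerFactor G u c

/-- `Z` is a meromorphic function on the whole complex plane that agrees near `0` with `f`. -/
def IsMeromorphicContinuation (f Z : ℂ → ℂ) : Prop :=
  Meromorphic Z ∧ ∀ᶠ u in 𝓝 (0 : ℂ), Z u = f u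

/-- `Z` has a pole of order exactly `k ≥ 1` at `a`. -/
def HasPoleOfOrder (Z : ℂ → ℂ) (a : ℂ) (k : ℤ) : Prop :=
  MeromorphicAt Z a ∧ 0 < k ∧ meromorphicOrderAt Z a = ((-k : ℤ) : WithTop ℤ)

end ModifiedZeta

/-! Let `M` be the 0/1 matrix of the relation `TwoStep` on oriented edges. The Euler product is the
zeta function of the subshift with transition matrix `M`, so near `0` it equals `1 / det (1 - u M)`.
To see this, count closed words of length `ℓ` with weight `u ^ ℓ / ℓ` in two ways: by length they
give `∑ u ^ n / n * tr (M ^ n)`, and as powers of primitive words, up to rotation, they give the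
logarithm of the product (`hasProd_primitiveClass`). The order of the pole at `1/2` is therefore the
algebraic multiplicity of the eigenvalue `2` of `M`.

With `T` the non-backtracking edge matrix, `M = T ^ 2 + 1` (`relMatrix_twoStep`), so the eigenvalue
`2` of `M` corresponds to the eigenvalue `1` of `T ^ 2`. Since `m ≠ n`, the kernel of `M - 2`
consists exactly of the functions whose sums over the edges leaving, and over the edges entering,
each vertex vanish (`ker_vertexSumMatrix_eq`). The image of `M - 2` is orthogonal to these
functions, so there are no Jordan blocks (`maxGenEigenspace_twoStep_eq_ker`).

The multiplicity is thus `2m - 2n` plus the number of linear relations among the `2n` vertex sums: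
two relations for a bipartite graph, one otherwise. -/

namespace ModifiedZeta

/-! ### Combinatorics on words: powers, periods and rotations -/

section Words

variable {α : Type*}

/-- The word `l` repeated `k` times. -/
def wordPow (l : List α) (k : ℕ) : List α := (List.replicate k l).flatten

@[simp] lemma wordPow_zero (l : List α) : wordPow l 0 = [] := rfl

lemma wordPow_succ (l : List α) (k : ℕ) : wordPow l (k + 1) = l ++ wordPow l k := by
  simp [wordPow, List.replicate_succ]

@[simp] lemma length_wordPow (l : List α) (k : ℕ) : (wordPow l k).length = k * l.length := by
  simp [wordPow]

lemma wordPow_cons_append (a : α) (t : List α) (k : ℕ) :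
    wordPow (a :: t) k ++ [a] = a :: wordPow (t ++ [a]) k := by
  induction k with
  | zero => simp
  | succ k ih => simp [wordPow_succ, ih]

lemma wordPow_rotate_one (l : List α) (k : ℕ) :
    (wordPow l k).rotate 1 = wordPow (l.rotate 1) k := by
  cases l with
  | nil => simp [wordPow]
  | cons a t =>
    cases k with
    | zero => simp
    | succ k => simp [wordPow_succ, wordPow_cons_append]

lemma wordPow_rotate (l : List α) (k n : ℕ) :
    (wordPow l k).rotate n = wordPow (l.rotate n) k := by
  induction n with
  | zero => simp
  | succ n ih => rw [← List.rotate_rotate, ih, wordPow_rotate_one, List.rotate_rotate]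

lemma wordPow_injective {k : ℕ} (hk : k ≠ 0) :
    Function.Injective fun l : List α => wordPow l k := by
  intro l l' h
  obtain ⟨j, rfl⟩ := Nat.exists_eq_succ_of_ne_zero hk
  have hlen : l.length = l'.length := by
    have := congrArg List.length h
    simpa using this
  simp only [Nat.succ_eq_add_one, wordPow_succ] at h
  exact (List.append_inj h hlen).1

lemma eq_wordPow_of_append_comm (x : List α) (k : ℕ) :
    ∀ r : List α, x ++ r = r ++ x → r.length = k * x.length → r = wordPow x k := by
  induction k with
  | zero => intro r _ h; simpa using h
  | succ k ih =>
    intro r hc hl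
    have hle : x.length ≤ r.length := by rw [hl]; nlinarith
    obtain ⟨s, rfl⟩ : x <+: r := by
      apply List.prefix_of_prefix_length_le (l₃ := r ++ x) _ (List.prefix_append _ _) hle
      rw [← hc]; exact List.prefix_append _ _
    rw [wordPow_succ, ← ih s]
    · simpa using hc
    · have : x.length + s.length = k * x.length + x.length := by
        simpa [add_mul] using hl
      omega

/-- The least `n ≥ 1` such that rotating by `n` fixes the word (for nonempty words). -/
noncomputable def period (l : List α) : ℕ :=
  Function.minimalPeriod (fun x : List α => x.rotate 1) l

lemma iterate_rotate_one (l : List α) (n : ℕ) :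
    (fun x : List α => x.rotate 1)^[n] l = l.rotate n := by
  induction n with
  | zero => simp
  | succ n ih => rw [Function.iterate_succ_apply', ih, List.rotate_rotate]

lemma isPeriodicPt_rotate_iff (l : List α) (n : ℕ) :
    Function.IsPeriodicPt (fun x : List α => x.rotate 1) n l ↔ l.rotate n = l := by
  rw [Function.IsPeriodicPt, Function.IsFixedPt, iterate_rotate_one]

lemma rotate_eq_self_iff_period_dvd (l : List α) (n : ℕ) : l.rotate n = l ↔ period l ∣ n := by
  rw [← isPeriodicPt_rotate_iff, Function.isPeriodicPt_iff_minimalPeriod_dvd, period]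

lemma period_dvd_length (l : List α) : period l ∣ l.length :=
  (rotate_eq_self_iff_period_dvd l _).1 l.rotate_length

lemma period_pos {l : List α} (hl : l ≠ []) : 0 < period l :=
  Nat.pos_of_dvd_of_pos (period_dvd_length l) (List.length_pos_of_ne_nil hl)

lemma period_wordPow (l : List α) {k : ℕ} (hk : k ≠ 0) : period (wordPow l k) = period l := by
  refine Function.minimalPeriod_eq_minimalPeriod_iff.2 fun n => ?_
  rw [isPeriodicPt_rotate_iff, isPeriodicPt_rotate_iff, wordPow_rotate]
  exact (wordPow_injective hk).eq_iff

/-- Invariance under rotation by the period says that the initial segment of that length commutes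
with the rest of the word, which forces the rest to be a power of it. -/
lemma exists_eq_wordPow {l : List α} (hl : l ≠ []) :
    ∃ (b : List α) (k : ℕ), k ≠ 0 ∧ l = wordPow b k ∧ period b = b.length := by
  obtain ⟨k, hk⟩ := period_dvd_length l
  have hpos := List.length_pos_of_ne_nil hl
  have hp := period_pos hl
  have hk0 : k ≠ 0 := by rintro rfl; omega
  have hle : period l ≤ l.length := Nat.le_of_dvd hpos (period_dvd_length l)
  have hlen : (l.take (period l)).length = period l := by simp [hle]
  obtain ⟨j, rfl⟩ := Nat.exists_eq_succ_of_ne_zero hk0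
  have hlb : l = wordPow (l.take (period l)) (j + 1) := by
    have hrot := (rotate_eq_self_iff_period_dvd l _).2 dvd_rfl
    rw [List.rotate_eq_drop_append_take hle] at hrot
    rw [wordPow_succ, ← eq_wordPow_of_append_comm _ j (l.drop (period l))]
    · rw [List.take_append_drop]
    · rw [List.take_append_drop, hrot]
    · rw [hlen, List.length_drop, hk, Nat.succ_eq_add_one, mul_add, mul_one, mul_comm j]; omega
  refine ⟨l.take (period l), j + 1, hk0, hlb, ?_⟩
  rw [hlen, ← period_wordPow _ hk0, Nat.succ_eq_add_one, ← hlb]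

variable (R : α → α → Prop)

/-- A nonempty cyclic `R`-chain. -/
def IsCyclicWord (l : List α) : Prop := l ≠ [] ∧ Cycle.Chain R (l : Cycle α)

/-- A nonempty cyclic `R`-chain that is not a proper power. -/
def IsPrimitiveWord (l : List α) : Prop := IsCyclicWord R l ∧ period l = l.length

variable {R}

lemma isCyclicWord_wordPow_iff {l : List α} {k : ℕ} (hk : k ≠ 0) :
    IsCyclicWord R (wordPow l k) ↔ IsCyclicWord R l := by
  obtain ⟨j, rfl⟩ := Nat.exists_eq_succ_of_ne_zero hk
  cases l with
  | nil => simp [IsCyclicWord, wordPow]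
  | cons a t =>
    -- Repeating the first letter at the end makes the cyclic condition linear; the chain then
    -- splits at the start of each copy.
    have key : ∀ j, List.IsChain R (wordPow (a :: t) (j + 1) ++ [a]) ↔
        List.IsChain R (a :: t ++ [a]) := by
      intro j
      induction j with
      | zero => simp [wordPow_succ]
      | succ j ih =>
        have h : wordPow (a :: t) (j + 1 + 1) ++ [a] =
            (a :: t) ++ a :: (t ++ wordPow (a :: t) j ++ [a]) := by
          simp [wordPow_succ]
        have h' : wordPow (a :: t) (j + 1) ++ [a] = a :: (t ++ wordPow (a :: t) j ++ [a]) := by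
          simp [wordPow_succ]
        rw [h, List.isChain_split, ← h', ih, and_self_iff]
    have := key j
    simpa [IsCyclicWord, wordPow_succ, Cycle.chain_coe_cons] using this

/-- Links primeness in terms of shorter cycles to the period. A power of `b` has the period of `b`,
which is at most the length of `b`. -/
lemma isPrimitiveWord_iff {l : List α} :
    IsPrimitiveWord R l ↔ IsCyclicWord R l ∧
      ∀ (b : List α) (r : ℕ), IsCyclicWord R b → b.length < l.length → l ≠ wordPow b r := by
  refine and_congr_right fun hl => ⟨fun hp b r hb hlt h => ?_, fun h => ?_⟩
  · have hr : r ≠ 0 := by rintro rfl; exact hl.1 (by simpa using h)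
    have h1 : period b = l.length := by rw [← hp, h, period_wordPow _ hr]
    have := Nat.le_of_dvd (List.length_pos_of_ne_nil hb.1) (period_dvd_length b)
    omega
  · obtain ⟨b, k, hk, rfl, hb⟩ := exists_eq_wordPow hl.1
    have hbc := (isCyclicWord_wordPow_iff hk).1 hl
    by_contra hne
    rw [period_wordPow _ hk, hb, length_wordPow] at hne
    refine h b k hbc ?_ rfl
    rw [length_wordPow]
    have : 1 * b.length ≤ k * b.length := Nat.mul_le_mul_right _ (Nat.pos_of_ne_zero hk)
    omega

variable (R)

/-- Every cyclic word is uniquely a power of a primitive one. -/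
noncomputable def primitivePowEquiv :
    {b // IsPrimitiveWord R b} × ℕ ≃ {l // IsCyclicWord R l} :=
  Equiv.ofBijective
    (fun p => ⟨wordPow p.1.1 (p.2 + 1), (isCyclicWord_wordPow_iff (Nat.succ_ne_zero _)).2 p.1.2.1⟩)
    (by
      constructor
      · rintro ⟨⟨b, hb⟩, k⟩ ⟨⟨c, hc⟩, j⟩ h
        have h : wordPow b (k + 1) = wordPow c (j + 1) := congrArg Subtype.val h
        have hlen : b.length = c.length := by
          rw [← hb.2, ← hc.2, ← period_wordPow b (Nat.succ_ne_zero k), h,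
            period_wordPow c (Nat.succ_ne_zero j)]
        have hkj : k = j := by
          have := congrArg List.length h
          rw [length_wordPow, length_wordPow, hlen] at this
          have := Nat.eq_of_mul_eq_mul_right (List.length_pos_of_ne_nil hc.1.1) this
          omega
        subst hkj
        have : b = c := wordPow_injective (Nat.succ_ne_zero k) h
        subst this
        rfl
      · rintro ⟨l, hl⟩
        obtain ⟨b, k, hk, rfl, hb⟩ := exists_eq_wordPow hl.1
        obtain ⟨j, rfl⟩ := Nat.exists_eq_succ_of_ne_zero hk
        exact ⟨⟨⟨b, (isCyclicWord_wordPow_iff hk).1 hl, hb⟩, j⟩, rfl⟩)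

variable {R}

lemma IsCyclicWord.of_isRotated {l l' : List α} (h : IsCyclicWord R l) (hr : l ~r l') :
    IsCyclicWord R l' := by
  have : (l : Cycle α) = l' := Quotient.sound hr
  refine ⟨?_, this ▸ h.2⟩
  rintro rfl
  exact h.1 (List.isRotated_nil_iff.1 hr)

lemma period_rotate (l : List α) (n : ℕ) : period (l.rotate n) = period l := by
  refine Function.minimalPeriod_eq_minimalPeriod_iff.2 fun m => ?_
  rw [isPeriodicPt_rotate_iff, isPeriodicPt_rotate_iff, List.rotate_rotate, add_comm,
    ← List.rotate_rotate, List.rotate_eq_rotate]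

lemma IsPrimitiveWord.of_isRotated {l l' : List α} (h : IsPrimitiveWord R l) (hr : l ~r l') :
    IsPrimitiveWord R l' := by
  refine ⟨h.1.of_isRotated hr, ?_⟩
  obtain ⟨n, rfl⟩ := hr
  rw [period_rotate, h.2, List.length_rotate]

/-- A primitive word has as many rotations as letters. -/
lemma IsPrimitiveWord.card_isRotated {l : List α} (h : IsPrimitiveWord R l) :
    Nat.card {l' : List α // (l' : Cycle α) = (l : Cycle α)} = l.length := by
  have hbij : Function.Bijective (fun i : Fin l.length =>
      (⟨l.rotate i, Quotient.sound (List.IsRotated.forall l i)⟩ :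
        {l' : List α // (l' : Cycle α) = (l : Cycle α)})) := by
    constructor
    · have key : ∀ i j : Fin l.length, i ≤ j → l.rotate i = l.rotate j → i = j := by
        intro i j hij hr
        have h1 : (l.rotate (j - i : ℕ)).rotate i = l.rotate i := by
          rw [List.rotate_rotate, Nat.sub_add_cancel hij, hr]
        rw [List.rotate_eq_rotate, rotate_eq_self_iff_period_dvd, h.2] at h1
        have := Nat.eq_zero_of_dvd_of_lt h1 (by omega)
        ext; have : (i : ℕ) ≤ j := hij
        omega
      intro i j hr
      have hr : l.rotate i = l.rotate j := congrArg Subtype.val hr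
      rcases le_total i j with hij | hij
      · exact key i j hij hr
      · exact (key j i hij hr.symm).symm
    · rintro ⟨l', hl'⟩
      obtain ⟨n, hn⟩ : l ~r l' := (Quotient.exact hl').symm
      refine ⟨⟨n % l.length, Nat.mod_lt _ (List.length_pos_of_ne_nil h.1.1)⟩, ?_⟩
      simpa [List.rotate_mod] using hn
  rw [← Nat.card_eq_of_bijective _ hbij, Nat.card_fin]

end Words

end ModifiedZeta

namespace ModifiedZeta

/-! ### Determinants and traces through eigenvalues -/

section MatrixRoots

variable {n K : Type*} [Fintype n] [DecidableEq n] [Field K] [IsAlgClosed K]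

open Polynomial in
/-- The determinant of a polynomial in a matrix, as a product over the eigenvalues. -/
lemma det_aeval_eq_prod_roots (A : Matrix n n K) (p : K[X]) :
    (aeval A p).det = (A.charpoly.roots.map fun x => p.eval x).prod := by
  have hsplit := IsAlgClosed.splits A.charpoly
  have hcard : A.charpoly.roots.card = Fintype.card n := by
    rw [← hsplit.natDegree_eq_card_roots, A.charpoly_natDegree_eq_dim]
  have hlin : ∀ a : K, (aeval A (X - C a)).det =
      (A.charpoly.roots.map fun x => (X - C a).eval x).prod := by
    intro a
    have h1 : aeval A (X - C a) = -(Matrix.scalar n a - A) := by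
      simp [Matrix.algebraMap_eq_diagonal, Matrix.scalar_apply, Pi.algebraMap_def]
    rw [h1, Matrix.det_neg, ← Matrix.eval_charpoly,
      hsplit.eval_eq_prod_roots_of_monic A.charpoly_monic, ← hcard]
    have h2 : (fun x => (X - C a).eval x) = fun x => -1 * (a - x) := by ext x; simp
    rw [h2, Multiset.prod_map_mul, Multiset.map_const', Multiset.prod_replicate]
  -- Both sides are multiplicative in the polynomial, so only linear factors and the leading
  -- coefficient matter.
  have hprod : ∀ s : Multiset K, (aeval A (s.map fun a => X - C a).prod).det =
      (A.charpoly.roots.map fun x => ((s.map fun a => X - C a).prod).eval x).prod := by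
    intro s
    induction s using Multiset.induction_on with
    | empty => simp
    | cons a s ih =>
      simp only [Multiset.map_cons, Multiset.prod_cons, map_mul, Matrix.det_mul, ih, hlin,
        eval_mul, Multiset.prod_map_mul]
  conv_lhs => rw [(IsAlgClosed.splits p).eq_prod_roots]
  conv_rhs => rw [(IsAlgClosed.splits p).eq_prod_roots]
  simp only [map_mul, Matrix.det_mul, hprod, eval_mul, Multiset.prod_map_mul, eval_C, aeval_C,
    Multiset.map_const', Multiset.prod_replicate, hcard, Matrix.algebraMap_eq_diagonal,
    Matrix.det_diagonal]
  simp

open Polynomial in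
lemma det_one_sub_smul_eq_prod_roots (A : Matrix n n K) (u : K) :
    (1 - u • A).det = (A.charpoly.roots.map fun x => 1 - u * x).prod := by
  have := det_aeval_eq_prod_roots A (1 - C u * X)
  simpa [Algebra.smul_def] using this

-- The determinant formula for the polynomial `z - X ^ k` gives the characteristic polynomial of `A
-- ^ k` at `z`.
open Polynomial in
lemma trace_pow_eq_sum_roots (A : Matrix n n K) (k : ℕ) :
    (A ^ k).trace = (A.charpoly.roots.map fun x => x ^ k).sum := by
  have hchar : (A ^ k).charpoly =
      ((A.charpoly.roots.map fun x => x ^ k).map fun a => X - C a).prod := by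
    refine Polynomial.funext fun z => ?_
    have h1 := det_aeval_eq_prod_roots A (C z - X ^ k)
    rw [Matrix.eval_charpoly, eval_multiset_prod, Multiset.map_map, Multiset.map_map]
    simpa [Matrix.algebraMap_eq_diagonal, Matrix.scalar_apply, Pi.algebraMap_def,
      Function.comp_def] using h1
  rw [Matrix.trace_eq_sum_roots_charpoly, hchar, roots_multiset_prod_X_sub_C]

end MatrixRoots

lemma hasSum_multiset_map_sum {ι κ : Type*} (s : Multiset κ) (f : κ → ι → ℂ) (a : κ → ℂ)
    (h : ∀ x ∈ s, HasSum (f x) (a x)) :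
    HasSum (fun i => (s.map fun x => f x i).sum) (s.map a).sum := by
  induction s using Multiset.induction_on with
  | empty => simp
  | cons x s ih =>
    simp only [Multiset.map_cons, Multiset.sum_cons]
    exact (h x (by simp)).add (ih fun y hy => h y (by simp [hy]))

lemma exp_sum_neg_log_eq_inv_prod (s : Multiset ℂ) (u : ℂ) (h : ∀ x ∈ s, ‖u * x‖ < 1) :
    Complex.exp ((s.map fun x => -Complex.log (1 - u * x)).sum) =
      ((s.map fun x => 1 - u * x).prod)⁻¹ := by
  induction s using Multiset.induction_on with
  | empty => simp
  | cons x s ih =>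
    have hx : 1 - u * x ≠ 0 := by
      intro h0
      have := h x (by simp)
      rw [← sub_eq_zero.1 h0] at this
      simp at this
    simp only [Multiset.map_cons, Multiset.sum_cons, Multiset.prod_cons]
    rw [Complex.exp_add, ih fun y hy => h y (by simp [hy]), Complex.exp_neg, Complex.exp_log hx,
      mul_inv]

lemma eventually_norm_mul_lt_one (s : Multiset ℂ) :
    ∀ᶠ u in 𝓝 (0 : ℂ), ∀ x ∈ s, ‖u * x‖ < 1 := by
  induction s using Multiset.induction_on with
  | empty => simp
  | cons x s ih =>
    have hx : ∀ᶠ u in 𝓝 (0 : ℂ), ‖u * x‖ < 1 := by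
      have hc : Continuous fun u : ℂ => ‖u * x‖ := by fun_prop
      exact hc.continuousAt.eventually_lt continuousAt_const (by simp)
    filter_upwards [hx, ih] with u h1 h2 y hy
    rcases Multiset.mem_cons.1 hy with rfl | hy
    exacts [h1, h2 y hy]

end ModifiedZeta

namespace ModifiedZeta

/-! ### The Euler product of a relation on a finite alphabet -/

section ClosedWords

variable {α : Type*}

lemma norm_pow_div_length_le (u : ℂ) (l : List α) :
    ‖u ^ l.length / (l.length : ℂ)‖ ≤ ‖u‖ ^ l.length := by
  rw [norm_div, norm_pow, Complex.norm_natCast]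
  rcases Nat.eq_zero_or_pos l.length with h | h
  · simp [h]
  · exact div_le_self (by positivity) (by exact_mod_cast h)

variable [Fintype α] (R : α → α → Prop)

open Classical in
/-- The transition matrix of a relation. -/
noncomputable def relMatrix : Matrix α α ℂ := Matrix.of fun a b => if R a b then 1 else 0

-- A path of `k + 1` steps has `k` interior letters, hence the shift in the exponent.
open Classical in
lemma relMatrix_pow_apply [DecidableEq α] (k : ℕ) (a b : α) :
    (relMatrix R ^ (k + 1)) a b =
      ∑ f : Fin k → α, if List.IsChain R (a :: (List.ofFn f ++ [b])) then (1 : ℂ) else 0 := by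
  induction k generalizing a with
  | zero => simp [relMatrix]
  | succ k ih =>
    rw [pow_succ', Matrix.mul_apply, ← (Fin.consEquiv fun _ => α).sum_comp,
      Fintype.sum_prod_type]
    refine Finset.sum_congr rfl fun c _ => ?_
    rw [ih, Finset.mul_sum]
    refine Finset.sum_congr rfl fun f _ => ?_
    by_cases h : R a c <;> simp [relMatrix, Fin.consEquiv, List.ofFn_succ, h]

open Classical in
lemma trace_relMatrix_pow [DecidableEq α] {k : ℕ} (hk : k ≠ 0) :
    (relMatrix R ^ k).trace =
      ∑ f : Fin k → α, if IsCyclicWord R (List.ofFn f) then (1 : ℂ) else 0 := by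
  obtain ⟨j, rfl⟩ : ∃ j, k = j + 1 := Nat.exists_eq_succ_of_ne_zero hk
  rw [← (Fin.consEquiv fun _ => α).sum_comp, Fintype.sum_prod_type, Matrix.trace]
  refine Finset.sum_congr rfl fun c _ => ?_
  rw [Matrix.diag_apply, relMatrix_pow_apply]
  refine Finset.sum_congr rfl fun f _ => ?_
  simp [Fin.consEquiv, List.ofFn_succ, IsCyclicWord, Cycle.chain_coe_cons]

lemma summable_norm_pow_length {u : ℂ} (hu : ‖u * Fintype.card α‖ < 1) :
    Summable fun l : List α => ‖u‖ ^ l.length := by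
  rw [← List.equivSigmaTuple.symm.summable_iff, summable_sigma_of_nonneg (fun _ => by simp)]
  refine ⟨fun n => Summable.of_finite, ?_⟩
  have : (fun n : ℕ => ∑' f : Fin n → α, ((fun l : List α => ‖u‖ ^ l.length) ∘
      List.equivSigmaTuple.symm) ⟨n, f⟩) = fun n => ‖u * Fintype.card α‖ ^ n := by
    ext n
    simp [List.equivSigmaTuple, tsum_fintype, mul_pow, mul_comm]
  rw [this]
  exact summable_geometric_of_norm_lt_one (by simpa using hu)

-- Grouping by length gives `∑ u ^ n / n * tr (M ^ n)`, a logarithm series for each eigenvalue.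
-- Keeping one logarithm per eigenvalue avoids choosing a branch of the logarithm of the
-- determinant.
open Classical in
lemma hasSum_cyclicWord [DecidableEq α] {u : ℂ} (hu : ‖u * Fintype.card α‖ < 1)
    (hr : ∀ x ∈ (relMatrix R).charpoly.roots, ‖u * x‖ < 1) :
    HasSum (fun l : {l : List α // IsCyclicWord R l} =>
        u ^ l.1.length / (l.1.length : ℂ))
      ((relMatrix R).charpoly.roots.map fun x => -Complex.log (1 - u * x)).sum := by
  set F : List α → ℂ := fun l => if IsCyclicWord R l then u ^ l.length / (l.length : ℂ) else 0
    with hF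
  have hsum : Summable F := by
    refine (summable_norm_pow_length hu).of_norm_bounded fun l => ?_
    rw [hF]
    dsimp only
    split_ifs
    · exact norm_pow_div_length_le u l
    · simp
  have h1 : HasSum (fun l : {l : List α // IsCyclicWord R l} =>
      u ^ l.1.length / (l.1.length : ℂ)) (∑' l, F l) := by
    have h2 : F = Set.indicator {l | IsCyclicWord R l}
        (fun l => u ^ l.length / (l.length : ℂ)) := by
      ext l; simp [hF, Set.indicator_apply]
    have h3 := hsum.hasSum
    rw [h2] at h3
    rw [h2]
    exact hasSum_subtype_iff_indicator.2 h3
  have h4 : HasSum (fun n : ℕ => u ^ n / (n : ℂ) * (relMatrix R ^ n).trace) (∑' l, F l) := by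
    refine HasSum.sigma (List.equivSigmaTuple.symm.hasSum_iff.2 hsum.hasSum) fun n => ?_
    convert hasSum_fintype _ using 1
    -- For `n = 0` both sides vanish: the empty word is not cyclic, and division by zero gives zero.
    rcases eq_or_ne n 0 with rfl | hn
    · simp [List.equivSigmaTuple, hF, IsCyclicWord]
    · rw [trace_relMatrix_pow R hn, Finset.mul_sum]
      refine Finset.sum_congr rfl fun f _ => ?_
      simp [List.equivSigmaTuple, hF]
  have h5 := hasSum_multiset_map_sum (relMatrix R).charpoly.roots
    (fun x (n : ℕ) => (u * x) ^ n / (n : ℂ)) (fun x => -Complex.log (1 - u * x))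
    fun x hx => Complex.hasSum_taylorSeries_neg_log (hr x hx)
  have h6 : (fun n : ℕ => u ^ n / (n : ℂ) * (relMatrix R ^ n).trace) = fun n : ℕ =>
      ((relMatrix R).charpoly.roots.map fun x => (u * x) ^ n / (n : ℂ)).sum := by
    ext n
    rw [trace_pow_eq_sum_roots, ← Multiset.sum_map_mul_left]
    refine congrArg Multiset.sum (Multiset.map_congr rfl fun x _ => ?_)
    rw [mul_pow]; ring
  rw [h6] at h4
  rw [← h4.unique h5]
  exact h1

lemma norm_pow_lt_one_of_card {u : ℂ} (hu : ‖u * Fintype.card α‖ < 1) {l : List α} (hl : l ≠ []) :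
    ‖u ^ l.length‖ < 1 := by
  have : Nonempty α := ⟨l.head hl⟩
  have hc : (1 : ℝ) ≤ Fintype.card α := by exact_mod_cast Fintype.card_pos
  rw [norm_mul, Complex.norm_natCast] at hu
  have h1 : ‖u‖ < 1 := by nlinarith [norm_nonneg u]
  rw [norm_pow]
  exact pow_lt_one₀ (norm_nonneg u) h1 (List.length_pos_of_ne_nil hl).ne'

/-- The classes of primitive cyclic words under rotation. -/
def PrimitiveClass : Type _ :=
  {c : Cycle α // ∃ l : List α, IsPrimitiveWord R l ∧ (l : Cycle α) = c}

/-- The powers of a primitive word of length `ℓ` contribute `∑ u ^ (k ℓ) / (k ℓ)` over `k ≥ 1`, a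
logarithm series divided by `ℓ`. -/
lemma hasSum_primitiveWord [DecidableEq α] {u : ℂ} (hu : ‖u * Fintype.card α‖ < 1)
    (hr : ∀ x ∈ (relMatrix R).charpoly.roots, ‖u * x‖ < 1) :
    HasSum (fun b : {b : List α // IsPrimitiveWord R b} =>
        -Complex.log (1 - u ^ b.1.length) / (b.1.length : ℂ))
      ((relMatrix R).charpoly.roots.map fun x => -Complex.log (1 - u * x)).sum := by
  refine HasSum.prod_fiberwise ((primitivePowEquiv R).hasSum_iff.2 (hasSum_cyclicWord R hu hr))
    fun b => ?_
  have h := (Complex.hasSum_taylorSeries_neg_log' (norm_pow_lt_one_of_card hu b.2.1.1)).div_const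
    (b.1.length : ℂ)
  have heq : ∀ k : ℕ, u ^ (wordPow b.1 (k + 1)).length / ((wordPow b.1 (k + 1)).length : ℂ) =
      (u ^ b.1.length) ^ (k + 1) / ((k : ℂ) + 1) / (b.1.length : ℂ) := by
    intro k
    rw [length_wordPow]
    push_cast
    rw [div_div, ← pow_mul, mul_comm b.1.length (k + 1)]
  simp_rw [← heq] at h
  exact h

/-- A class of length `ℓ` contains `ℓ` distinct words, which cancels the weight `1 / ℓ`. -/
lemma hasSum_primitiveClass [DecidableEq α] {u : ℂ} (hu : ‖u * Fintype.card α‖ < 1)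
    (hr : ∀ x ∈ (relMatrix R).charpoly.roots, ‖u * x‖ < 1) :
    HasSum (fun c : PrimitiveClass R => -Complex.log (1 - u ^ c.1.length))
      ((relMatrix R).charpoly.roots.map fun x => -Complex.log (1 - u * x)).sum := by
  let q : {b : List α // IsPrimitiveWord R b} → PrimitiveClass R :=
    fun b => ⟨(b.1 : Cycle α), b.1, b.2, rfl⟩
  refine HasSum.sigma ((Equiv.sigmaFiberEquiv q).hasSum_iff.2 (hasSum_primitiveWord R hu hr))
    fun c => ?_
  obtain ⟨c, l, hl, rfl⟩ := c
  let e : {b // q b = ⟨(l : Cycle α), l, hl, rfl⟩} ≃ {l' : List α // (l' : Cycle α) = l} :=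
    { toFun := fun b => ⟨b.1.1, congrArg Subtype.val b.2⟩
      invFun := fun l' => ⟨⟨l'.1, hl.of_isRotated (Quotient.exact l'.2).symm⟩, Subtype.ext l'.2⟩
      left_inv := fun _ => rfl
      right_inv := fun _ => rfl }
  have hcard := hl.card_isRotated
  have hpos := List.length_pos_of_ne_nil hl.1.1
  have hne : (l.length : ℂ) ≠ 0 := by exact_mod_cast hpos.ne'
  have : Finite {l' : List α // (l' : Cycle α) = l} :=
    Nat.finite_of_card_ne_zero (by rw [hcard]; exact hpos.ne')
  have := Fintype.ofFinite {l' : List α // (l' : Cycle α) = l}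
  rw [← e.symm.hasSum_iff]
  have hlen : ∀ l' : {l' : List α // (l' : Cycle α) = l}, l'.1.length = l.length := fun l' => by
    have := congrArg Cycle.length l'.2
    simpa using this
  have hval : ∀ l' : {l' : List α // (l' : Cycle α) = l},
      ((Equiv.sigmaFiberEquiv q) ⟨_, e.symm l'⟩ : List α) = l'.1 := fun _ => rfl
  convert hasSum_fintype fun _ : {l' : List α // (l' : Cycle α) = l} =>
    -Complex.log (1 - u ^ l.length) / (l.length : ℂ) using 1
  · ext l'
    simp only [Function.comp_apply, hval, hlen]
  · simp only [Finset.sum_const, Finset.card_univ, Cycle.length_coe, ← Nat.card_eq_fintype_card,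
      hcard, nsmul_eq_mul]
    field_simp

lemma hasProd_primitiveClass [DecidableEq α] {u : ℂ} (hu : ‖u * Fintype.card α‖ < 1)
    (hr : ∀ x ∈ (relMatrix R).charpoly.roots, ‖u * x‖ < 1) :
    HasProd (fun c : PrimitiveClass R => (1 - u ^ c.1.length)⁻¹) ((1 - u • relMatrix R).det)⁻¹ := by
  rw [det_one_sub_smul_eq_prod_roots, ← exp_sum_neg_log_eq_inv_prod _ _ hr]
  refine (hasSum_primitiveClass R hu hr).cexp.congr fun s => Finset.prod_congr rfl fun c _ => ?_
  obtain ⟨c, l, hl, rfl⟩ := c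
  have hlt := norm_pow_lt_one_of_card hu hl.1.1
  have hne : 1 - u ^ l.length ≠ 0 := by
    intro h0
    rw [← sub_eq_zero.1 h0] at hlt
    simp at hlt
  change Complex.exp (-Complex.log (1 - u ^ l.length)) = (1 - u ^ l.length)⁻¹
  rw [Complex.exp_neg, Complex.exp_log hne]

end ClosedWords

end ModifiedZeta

namespace ModifiedZeta

/-! ### Linear relations among the vertex sums -/

section EdgeMatrices

variable {V : Type*} (G : SimpleGraph V)

lemma not_isTwoStepArc_self (e : G.Dart) : ¬ IsTwoStepArc G e e := by
  rintro ⟨g, hg, -, h1, h2⟩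
  refine hg (SimpleGraph.Dart.ext _ _ (Prod.ext ?_ ?_))
  · simpa using h1
  · simpa using h2

variable {G} in
lemma eq_of_forall_adj_eq (hconn : G.Connected) {β : Type*} {f : V → β}
    (h : ∀ u v, G.Adj u v → f u = f v) (u v : V) : f u = f v := by
  obtain ⟨p⟩ := hconn.preconnected u v
  induction p with
  | nil => rfl
  | cons hadj _ ih => exact (h _ _ hadj).trans ih

-- By the handshake lemma `2m ≥ 3n`. The strict inequality makes the pole orders positive and rules
-- out `m = n` in the kernel computation.
variable {G} in
lemma card_lt_card_edgeFinset [Fintype V] [DecidableRel G.Adj]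
    (hconn : G.Connected) (hdeg : 3 ≤ G.minDegree) :
    Fintype.card V < G.edgeFinset.card := by
  have h := G.sum_degrees_eq_twice_card_edges
  have h2 : ∑ _v : V, 3 ≤ ∑ v, G.degree v :=
    Finset.sum_le_sum fun v _ => hdeg.trans (G.minDegree_le_degree v)
  have := hconn.nonempty
  have := Fintype.card_pos (α := V)
  simp at h2
  omega

lemma sum_symm [Fintype V] [DecidableRel G.Adj] (x : G.Dart → ℂ) : ∑ e : G.Dart, x e.symm = ∑ e, x e :=
  Equiv.sum_comp (SimpleGraph.Dart.symm_involutive (G := G)).toPerm x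

/-- The matrix of the map sending `x` to its sums over outgoing and over incoming edges. -/
def vertexSumMatrix [DecidableEq V] : Matrix (V ⊕ V) G.Dart ℂ :=
  Matrix.of fun s e => Sum.elim (fun v => if e.fst = v then 1 else 0)
    (fun v => if e.snd = v then 1 else 0) s

lemma mem_ker_vertexSumMatrix_transpose [Fintype V] [DecidableEq V] (h : V ⊕ V → ℂ) :
    h ∈ (vertexSumMatrix G).transpose.mulVecLin.ker ↔
      ∀ u v, G.Adj u v → h (Sum.inl u) + h (Sum.inr v) = 0 := by
  rw [LinearMap.mem_ker, Matrix.mulVecLin_apply, funext_iff]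
  have : ∀ e : G.Dart, (vertexSumMatrix G).transpose.mulVec h e =
      h (Sum.inl e.fst) + h (Sum.inr e.snd) := fun e => by
    simp [vertexSumMatrix, Matrix.mulVec, dotProduct]
  simp only [this]
  exact ⟨fun H u v huv => H ⟨(u, v), huv⟩, fun H e => H _ _ e.adj⟩

variable {G} in
lemma inl_sub_inr_eq (hconn : G.Connected) {h : V ⊕ V → ℂ}
    (hh : ∀ u v, G.Adj u v → h (Sum.inl u) + h (Sum.inr v) = 0) (u v : V) :
    h (Sum.inl u) - h (Sum.inr u) = h (Sum.inl v) - h (Sum.inr v) :=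
  eq_of_forall_adj_eq hconn (f := fun v => h (Sum.inl v) - h (Sum.inr v))
    (fun u v huv => by
      linear_combination hh u v huv - hh v u huv.symm) u v

variable {G} in
/-- A nonzero function that changes sign along every edge of a connected graph gives a 2-colouring. -/
lemma isBipartite_of_antisymmetric (hconn : G.Connected) {q : V → ℂ}
    (hq : ∀ u v, G.Adj u v → q u = -q v) {v₀ : V} (h0 : q v₀ ≠ 0) : G.IsBipartite := by
  have hpm : ∀ v, q v = q v₀ ∨ q v = -q v₀ := fun v =>
    sq_eq_sq_iff_eq_or_eq_neg.1 (eq_of_forall_adj_eq hconn (f := fun v => q v ^ 2)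
      (fun u v huv => by rw [hq u v huv, neg_sq]) v v₀)
  have hne : -q v₀ ≠ q v₀ := fun h => h0 (by linear_combination -h / 2)
  have hval : ∀ {u v}, G.Adj u v → decide (q u = q v₀) ≠ decide (q v = q v₀) := by
    intro u v huv h
    rw [decide_eq_decide] at h
    have huv := hq u v huv
    rcases hpm v with hv | hv
    · rw [h.2 hv, hv] at huv
      exact hne huv.symm
    · rw [hv, neg_neg] at huv
      exact hne (hv.symm.trans (h.1 huv))
  exact (SimpleGraph.Coloring.mk (fun v => decide (q v = q v₀)) hval).colorable

-- For a relation with components `f` and `g`, the difference `f - g` is constant and `f + g`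
-- changes sign along every edge. In the bipartite case the latter is a multiple of the sign `σ` of
-- the colouring, which leaves two free constants.
variable {G} in
lemma finrank_ker_vertexSumMatrix_transpose_of_isBipartite [Fintype V] [DecidableEq V]
    (hconn : G.Connected)
    (hbip : G.IsBipartite) :
    Module.finrank ℂ (vertexSumMatrix G).transpose.mulVecLin.ker = 2 := by
  obtain ⟨C⟩ := hbip
  obtain ⟨v₀⟩ := hconn.nonempty
  set σ : V → ℂ := fun v => if C v = 0 then 1 else -1 with hσ
  have hσ2 : ∀ v, σ v * σ v = 1 := fun v => by rw [hσ]; dsimp only; split_ifs <;> norm_num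
  have hσadj : ∀ u v, G.Adj u v → σ u + σ v = 0 := fun u v huv => by
    have hne := C.valid huv
    rw [hσ]; dsimp only
    split_ifs with h1 h2 h2
    · exact absurd (h1.trans h2.symm) hne
    · norm_num
    · norm_num
    · exact absurd (by omega) hne
  let Φ : ℂ × ℂ →ₗ[ℂ] (V ⊕ V → ℂ) :=
    { toFun := fun c => Sum.elim (fun v => c.1 + c.2 * σ v) (fun v => -c.1 + c.2 * σ v)
      map_add' := fun c d => by ext (v | v) <;> simp <;> ring
      map_smul' := fun r c => by ext (v | v) <;> simp <;> ring }
  have hinj : Function.Injective Φ := by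
    rw [← LinearMap.ker_eq_bot, LinearMap.ker_eq_bot']
    rintro ⟨c, d⟩ hcd
    have h1 : c + d * σ v₀ = 0 := congrFun hcd (Sum.inl v₀)
    have h2 : -c + d * σ v₀ = 0 := congrFun hcd (Sum.inr v₀)
    have hc : c = 0 := by linear_combination (h1 - h2) / 2
    have hd : d = 0 := by linear_combination σ v₀ * (h1 + h2) / 2 - d * hσ2 v₀
    rw [hc, hd]; rfl
  have hrange : LinearMap.range Φ = (vertexSumMatrix G).transpose.mulVecLin.ker := by
    ext h
    rw [mem_ker_vertexSumMatrix_transpose]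
    constructor
    · rintro ⟨⟨c, d⟩, rfl⟩ u v huv
      change c + d * σ u + (-c + d * σ v) = 0
      linear_combination d * hσadj u v huv
    · intro hh
      have h2 : ∀ v, σ v * (h (Sum.inl v) + h (Sum.inr v)) =
          σ v₀ * (h (Sum.inl v₀) + h (Sum.inr v₀)) := fun v =>
        eq_of_forall_adj_eq hconn (f := fun v => σ v * (h (Sum.inl v) + h (Sum.inr v)))
          (fun u v huv => by
            linear_combination (h (Sum.inl u) + h (Sum.inr u)) * hσadj u v huv -
              σ v * (hh u v huv + hh v u huv.symm)) v v₀
      refine ⟨((h (Sum.inl v₀) - h (Sum.inr v₀)) / 2,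
        σ v₀ * (h (Sum.inl v₀) + h (Sum.inr v₀)) / 2), ?_⟩
      ext (v | v)
      · change (h (Sum.inl v₀) - h (Sum.inr v₀)) / 2 +
          σ v₀ * (h (Sum.inl v₀) + h (Sum.inr v₀)) / 2 * σ v = h (Sum.inl v)
        linear_combination (inl_sub_inr_eq hconn hh v₀ v) / 2 - σ v * h2 v / 2 +
          (h (Sum.inl v) + h (Sum.inr v)) / 2 * hσ2 v
      · change -((h (Sum.inl v₀) - h (Sum.inr v₀)) / 2) +
          σ v₀ * (h (Sum.inl v₀) + h (Sum.inr v₀)) / 2 * σ v = h (Sum.inr v)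
        linear_combination -(inl_sub_inr_eq hconn hh v₀ v) / 2 - σ v * h2 v / 2 +
          (h (Sum.inl v) + h (Sum.inr v)) / 2 * hσ2 v
  rw [← hrange, LinearMap.finrank_range_of_inj hinj]
  simp

-- Without a 2-colouring the alternating part `f + g` must vanish, and only the constant difference
-- remains.
variable {G} in
lemma finrank_ker_vertexSumMatrix_transpose_of_not_isBipartite [Fintype V] [DecidableEq V]
    (hconn : G.Connected)
    (hbip : ¬ G.IsBipartite) :
    Module.finrank ℂ (vertexSumMatrix G).transpose.mulVecLin.ker = 1 := by
  obtain ⟨v₀⟩ := hconn.nonempty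
  let Φ : ℂ →ₗ[ℂ] (V ⊕ V → ℂ) :=
    { toFun := fun c => Sum.elim (fun _ => c) (fun _ => -c)
      map_add' := fun c d => by ext (v | v) <;> simp [add_comm]
      map_smul' := fun r c => by ext (v | v) <;> simp }
  have hinj : Function.Injective Φ := fun c d h => congrFun h (Sum.inl v₀)
  have hrange : LinearMap.range Φ = (vertexSumMatrix G).transpose.mulVecLin.ker := by
    ext h
    rw [mem_ker_vertexSumMatrix_transpose]
    constructor
    · rintro ⟨c, rfl⟩ u v _
      exact add_neg_cancel c
    · intro hh
      have hzero : ∀ v, h (Sum.inl v) + h (Sum.inr v) = 0 := fun v => by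
        by_contra hne
        exact hbip (isBipartite_of_antisymmetric hconn
          (q := fun v => h (Sum.inl v) + h (Sum.inr v))
          (fun u v huv => by
            linear_combination hh u v huv + hh v u huv.symm) hne)
      refine ⟨h (Sum.inl v₀), ?_⟩
      ext (v | v)
      · change h (Sum.inl v₀) = h (Sum.inl v)
        linear_combination (inl_sub_inr_eq hconn hh v₀ v + hzero v₀ - hzero v) / 2
      · change -h (Sum.inl v₀) = h (Sum.inr v)
        linear_combination -(inl_sub_inr_eq hconn hh v₀ v + hzero v₀ + hzero v) / 2
  rw [← hrange, LinearMap.finrank_range_of_inj hinj]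
  simp

/-! ### The eigenvalue 2 of the 2-step matrix -/

variable [Fintype V] [DecidableEq V] [DecidableRel G.Adj]

/-- The non-backtracking edge matrix. -/
def edgeMatrix : Matrix G.Dart G.Dart ℂ :=
  Matrix.of fun e g => if g.fst = e.snd ∧ g ≠ e.symm then 1 else 0

/-- In a simple graph the intermediate edge `g` is determined by its endpoints, so the square of the
edge matrix has entries 0 or 1. Its diagonal is zero because a 2-step-arc from `e` to itself would
need `g = e⁻¹`, so the identity adds without overlap. -/
lemma relMatrix_twoStep : relMatrix (TwoStep G) = edgeMatrix G * edgeMatrix G + 1 := by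
  ext e f
  have harc : (edgeMatrix G * edgeMatrix G) e f =
      ∑ g : G.Dart, if g ≠ e.symm ∧ g ≠ f.symm ∧ g.fst = e.snd ∧ g.snd = f.fst
        then (1 : ℂ) else 0 := by
    rw [Matrix.mul_apply]
    refine Finset.sum_congr rfl fun g _ => ?_
    have hfg : f = g.symm ↔ g = f.symm := by
      constructor <;> rintro rfl <;> simp
    simp only [edgeMatrix, Matrix.of_apply, mul_ite, mul_one, mul_zero, ← ite_and, Ne, hfg]
    refine if_congr ?_ rfl rfl
    rw [eq_comm (a := f.fst)]
    tauto
  rw [Matrix.add_apply, harc, relMatrix, Matrix.of_apply, Matrix.one_apply]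
  by_cases h : IsTwoStepArc G e f
  · have hne : e ≠ f := by rintro rfl; exact not_isTwoStepArc_self G e h
    have ht : TwoStep G e f := Or.inl h
    rw [if_pos ht, if_neg hne, add_zero]
    obtain ⟨g, hg⟩ := h
    rw [Finset.sum_eq_single g, if_pos hg]
    · intro g' _ hg'
      refine if_neg fun h' => hg' (SimpleGraph.Dart.ext _ _ (Prod.ext ?_ ?_))
      · rw [h'.2.2.1, hg.2.2.1]
      · rw [h'.2.2.2, hg.2.2.2]
    · simp
  · rw [Finset.sum_eq_zero, zero_add]
    · have ht : TwoStep G e f ↔ e = f := by simp [TwoStep, h]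
      simp only [ht]
    · intro g _
      exact if_neg fun hg => h ⟨g, hg⟩

/-- The sum of a function over the oriented edges with a given origin. -/
def outSum (x : G.Dart → ℂ) (v : V) : ℂ := ∑ e : G.Dart, if e.fst = v then x e else 0

/-- The sum of a function over the oriented edges with a given terminus. -/
def inSum (x : G.Dart → ℂ) (v : V) : ℂ := ∑ e : G.Dart, if e.snd = v then x e else 0

lemma outSum_symm (x : G.Dart → ℂ) (v : V) : outSum G (fun e => x e.symm) v = inSum G x v := by
  rw [outSum, inSum, ← sum_symm]
  refine Finset.sum_congr rfl fun e _ => ?_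
  simp

lemma inSum_symm (x : G.Dart → ℂ) (v : V) : inSum G (fun e => x e.symm) v = outSum G x v := by
  rw [← outSum_symm]; simp

lemma sum_mul_fst (x : G.Dart → ℂ) (p : V → ℂ) :
    ∑ e : G.Dart, x e * p e.fst = ∑ v, outSum G x v * p v := by
  simp only [outSum, Finset.sum_mul]
  rw [Finset.sum_comm]
  refine Finset.sum_congr rfl fun e _ => ?_
  simp [ite_mul]

lemma sum_mul_snd (x : G.Dart → ℂ) (p : V → ℂ) :
    ∑ e : G.Dart, x e * p e.snd = ∑ v, inSum G x v * p v := by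
  simp only [inSum, Finset.sum_mul]
  rw [Finset.sum_comm]
  refine Finset.sum_congr rfl fun e _ => ?_
  simp [ite_mul]

lemma outSum_star (x : G.Dart → ℂ) (v : V) : outSum G (star x) v = star (outSum G x v) := by
  simp only [outSum, star_sum]
  refine Finset.sum_congr rfl fun e _ => ?_
  split_ifs <;> simp

lemma inSum_star (x : G.Dart → ℂ) (v : V) : inSum G (star x) v = star (inSum G x v) := by
  simp only [inSum, star_sum]
  refine Finset.sum_congr rfl fun e _ => ?_
  split_ifs <;> simp

lemma edgeMatrix_mulVec (x : G.Dart → ℂ) (e : G.Dart) :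
    (edgeMatrix G).mulVec x e = outSum G x e.snd - x e.symm := by
  rw [Matrix.mulVec, dotProduct, outSum, eq_sub_iff_add_eq,
    ← Finset.sum_erase_add _ _ (Finset.mem_univ e.symm),
    ← Finset.sum_erase_add _ (fun g : G.Dart => if g.fst = e.snd then x g else 0)
      (Finset.mem_univ e.symm)]
  congr 1
  · rw [show edgeMatrix G e e.symm * x e.symm = 0 by simp [edgeMatrix], add_zero]
    refine Finset.sum_congr rfl fun g hg => ?_
    simp [edgeMatrix, Finset.ne_of_mem_erase hg]
  · simp

/-- The transition matrix of 2-steps minus twice the identity, as an operator. -/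
noncomputable def twoStepSubTwo : Module.End ℂ (G.Dart → ℂ) :=
  Matrix.toLin' (relMatrix (TwoStep G)) - algebraMap ℂ _ 2

/-- The two reversals in `T ^ 2` restore `x e`, which cancels. Every function in the image is thus a
function of the terminus minus a function of the origin. -/
lemma twoStepSubTwo_apply (x : G.Dart → ℂ) (e : G.Dart) :
    twoStepSubTwo G x e = outSum G ((edgeMatrix G).mulVec x) e.snd - outSum G x e.fst := by
  have h : twoStepSubTwo G x e = (edgeMatrix G).mulVec ((edgeMatrix G).mulVec x) e - x e := by
    simp only [twoStepSubTwo, relMatrix_twoStep, LinearMap.sub_apply, Matrix.toLin'_apply,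
      Matrix.add_mulVec, Matrix.one_mulVec, Matrix.mulVec_mulVec, Module.algebraMap_end_apply,
      Pi.sub_apply, Pi.add_apply, Pi.smul_apply, smul_eq_mul]
    ring
  rw [h, edgeMatrix_mulVec, edgeMatrix_mulVec]
  simp only [SimpleGraph.Dart.symm_symm, SimpleGraph.Dart.symm_toProd, Prod.snd_swap]
  ring

variable {G}

/-- When the outgoing sums vanish, `T` acts as minus edge reversal, and reversal exchanges outgoing
and incoming sums. -/
lemma twoStepSubTwo_eq_zero_of_outSum_inSum {x : G.Dart → ℂ} (ho : outSum G x = 0)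
    (hi : inSum G x = 0) : twoStepSubTwo G x = 0 := by
  ext e
  have h : (edgeMatrix G).mulVec x = -fun e => x e.symm := by
    ext e; simp [edgeMatrix_mulVec, ho]
  have h' : outSum G (-fun e => x e.symm) e.snd = -outSum G (fun e => x e.symm) e.snd := by
    simp only [outSum, ← Finset.sum_neg_distrib]
    refine Finset.sum_congr rfl fun e _ => ?_
    split_ifs <;> simp
  rw [twoStepSubTwo_apply, h, h', outSum_symm, ho, hi]
  simp

/-- On a connected graph with more edges than vertices, the eigenvectors for the eigenvalue `2`
have vanishing vertex sums. -/
lemma outSum_inSum_eq_zero_of_twoStepSubTwo (hconn : G.Connected)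
    (hcard : Fintype.card V ≠ G.edgeFinset.card) {y : G.Dart → ℂ} (hy : twoStepSubTwo G y = 0) :
    outSum G y = 0 ∧ inSum G y = 0 := by
  set z := (edgeMatrix G).mulVec y with hz
  set a := outSum G y with ha
  set b := outSum G z with hb
  have hab : ∀ e : G.Dart, a e.fst = b e.snd := fun e => by
    have := congrFun hy e
    rw [twoStepSubTwo_apply] at this
    exact (sub_eq_zero.1 this).symm
  have hyz : ∀ e : G.Dart, y e + z e.symm = a e.fst := fun e => by
    rw [hz, edgeMatrix_mulVec]; simp [ha]
  obtain ⟨v₀⟩ := hconn.nonempty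
  have hdart : (Fintype.card G.Dart : ℂ) = 2 * (G.edgeFinset.card : ℂ) := by
    exact_mod_cast G.dart_card_eq_twice_card_edges
  have hne : (Fintype.card V : ℂ) - (G.edgeFinset.card : ℂ) ≠ 0 := by
    rw [sub_ne_zero]; exact_mod_cast hcard
  have habs : ∀ e : G.Dart, a e.snd = b e.fst := fun e => by simpa using hab e.symm
  -- Along an edge `a` and `b` trade places, so `a + b` is constant and `a - b` changes sign.
  have hadj : ∀ u v, G.Adj u v → a u = b v ∧ a v = b u := fun u v h =>
    ⟨hab ⟨(u, v), h⟩, habs ⟨(u, v), h⟩⟩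
  -- the weighted sum of `hyz` over all oriented edges
  have hsum : ∀ w : V → ℂ, (∑ v, a v * w v) + ∑ e : G.Dart, z e * w e.snd =
      ∑ e : G.Dart, a e.fst * w e.fst := by
    intro w
    rw [ha, ← sum_mul_fst, ← ha, ← sum_symm G fun e => z e * w e.snd, ← Finset.sum_add_distrib]
    refine Finset.sum_congr rfl fun e _ => ?_
    rw [← hyz e]
    simp [add_mul]
  have hs : ∀ v, a v + b v = a v₀ + b v₀ := fun v =>
    eq_of_forall_adj_eq hconn (f := fun v => a v + b v)
      (fun u v h => by rw [(hadj u v h).1, (hadj u v h).2, add_comm]) v v₀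
  have hd : ∀ v, (a v - b v) ^ 2 = (a v₀ - b v₀) ^ 2 := fun v =>
    eq_of_forall_adj_eq hconn (f := fun v => (a v - b v) ^ 2)
      (fun u v h => by rw [(hadj u v h).1, (hadj u v h).2]; ring) v v₀
  -- Weight `1`: with `s` the constant value of `a + b`, the left side is `n s`. The right side is
  -- `m s`, half the sum of `s` over the `2m` oriented edges, as `a` and `b` have equal edge sums.
  have hs0 : a v₀ + b v₀ = 0 := by
    have h1 := hsum 1
    have h2 : ∑ e : G.Dart, z e * (1 : V → ℂ) e.snd = ∑ v, b v := by
      have := sum_mul_fst G z 1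
      simpa using this
    have h3 : ∑ e : G.Dart, a e.fst = ∑ e : G.Dart, b e.fst := by
      rw [← sum_symm G fun e => b e.fst]
      exact Finset.sum_congr rfl fun e _ => by simpa using hab e
    have h4 : ∑ e : G.Dart, (a e.fst + b e.fst) = ∑ _e : G.Dart, (a v₀ + b v₀) :=
      Finset.sum_congr rfl fun e _ => hs _
    have h5 : ∑ v, (a v + b v) = ∑ _v : V, (a v₀ + b v₀) := Finset.sum_congr rfl fun v _ => hs v
    rw [h2] at h1
    simp only [Pi.one_apply, mul_one] at h1
    simp only [Finset.sum_add_distrib, Finset.sum_const, Finset.card_univ, nsmul_eq_mul,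
      hdart] at h4 h5
    refine (mul_eq_zero.1 (?_ : ((Fintype.card V : ℂ) - (G.edgeFinset.card : ℂ)) *
      (a v₀ + b v₀) = 0)).resolve_left hne
    linear_combination h1 - h5 + h4 / 2 + h3 / 2
  -- Weight `a - b`: its sign change along edges gives in the same way `n d = m d`, with `d` the
  -- constant value of `(a - b) ^ 2`.
  have hd0 : (a v₀ - b v₀) ^ 2 = 0 := by
    have h1 := hsum fun v => a v - b v
    have h2 : ∑ e : G.Dart, z e * (a e.snd - b e.snd) = -∑ v, b v * (a v - b v) := by
      have := sum_mul_fst G z fun v => a v - b v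
      rw [← hb] at this
      rw [← this, ← Finset.sum_neg_distrib]
      refine Finset.sum_congr rfl fun e _ => ?_
      rw [hab e, habs e]; ring
    have h3 : ∑ e : G.Dart, a e.fst * (a e.fst - b e.fst) =
        -∑ e : G.Dart, b e.fst * (a e.fst - b e.fst) := by
      rw [← sum_symm G fun e => b e.fst * (a e.fst - b e.fst), ← Finset.sum_neg_distrib]
      refine Finset.sum_congr rfl fun e _ => ?_
      simp only [SimpleGraph.Dart.symm, Prod.fst_swap]
      rw [hab e, habs e]; ring
    have h4 : ∑ e : G.Dart, (a e.fst * (a e.fst - b e.fst) - b e.fst * (a e.fst - b e.fst)) =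
        ∑ _e : G.Dart, (a v₀ - b v₀) ^ 2 :=
      Finset.sum_congr rfl fun e _ => by rw [← hd e.fst]; ring
    have h5 : ∑ v, (a v * (a v - b v) - b v * (a v - b v)) = ∑ _v : V, (a v₀ - b v₀) ^ 2 :=
      Finset.sum_congr rfl fun v _ => by rw [← hd v]; ring
    rw [h2] at h1
    simp only [Finset.sum_sub_distrib, Finset.sum_const, Finset.card_univ, nsmul_eq_mul,
      hdart] at h4 h5
    refine (mul_eq_zero.1 (?_ : ((Fintype.card V : ℂ) - (G.edgeFinset.card : ℂ)) *
      (a v₀ - b v₀) ^ 2 = 0)).resolve_left hne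
    linear_combination h1 - h5 + h4 / 2 + h3 / 2
  have hab0 : ∀ v, a v = 0 ∧ b v = 0 := fun v => by
    have h1 := hs v
    have h2 := hd v
    rw [hs0] at h1
    rw [hd0, sq_eq_zero_iff] at h2
    constructor
    · linear_combination (h1 + h2) / 2
    · linear_combination (h1 - h2) / 2
  refine ⟨funext fun v => (hab0 v).1, funext fun v => ?_⟩
  -- Since `a = 0`, `y` is minus the reversal of `z`, so its incoming sums are `-b`.
  have hyn : y = fun e => -z e.symm := by
    ext e
    have := hyz e
    rw [(hab0 _).1] at this
    exact eq_neg_of_add_eq_zero_left this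
  have : inSum G (fun e => -z e.symm) v = -inSum G (fun e => z e.symm) v := by
    simp only [inSum, ← Finset.sum_neg_distrib]
    refine Finset.sum_congr rfl fun e _ => ?_
    split_ifs <;> simp
  rw [hyn, this, inSum_symm, ← hb, (hab0 v).2]
  simp

open scoped ComplexOrder in
/-- The image of `twoStepSubTwo` is orthogonal to the functions with vanishing vertex sums. -/
lemma eq_zero_of_twoStepSubTwo_eq {x y : G.Dart → ℂ} (hxy : twoStepSubTwo G y = x)
    (ho : outSum G x = 0) (hi : inSum G x = 0) : x = 0 := by
  have h : star x ⬝ᵥ x = 0 := by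
    -- Replacing only one factor of the inner product by this form leaves a combination of vertex
    -- sums of `star x`, all zero.
    have hx : ∀ e, x e = outSum G ((edgeMatrix G).mulVec y) e.snd - outSum G y e.fst := fun e => by
      rw [← hxy, twoStepSubTwo_apply]
    rw [dotProduct]
    calc ∑ e, star x e * x e
        = ∑ e, (star x e * outSum G ((edgeMatrix G).mulVec y) e.snd -
            star x e * outSum G y e.fst) :=
          Finset.sum_congr rfl fun e _ => by rw [hx e, mul_sub]
      _ = 0 := by
          rw [Finset.sum_sub_distrib, sum_mul_fst, sum_mul_snd]
          simp [outSum_star, inSum_star, ho, hi]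
  exact dotProduct_star_self_eq_zero.1 h

/-- Kernel and image of `twoStepSubTwo` meet only in `0`, so its powers have no larger kernel. -/
lemma maxGenEigenspace_twoStep_eq_ker (hconn : G.Connected)
    (hcard : Fintype.card V ≠ G.edgeFinset.card) :
    Module.End.maxGenEigenspace (Matrix.toLin' (relMatrix (TwoStep G))) 2 = (twoStepSubTwo G).ker := by
  have hN : Matrix.toLin' (relMatrix (TwoStep G)) - (2 : ℂ) • 1 = twoStepSubTwo G := by
    rw [twoStepSubTwo, Algebra.algebraMap_eq_smul_one]
  ext x
  rw [Module.End.mem_maxGenEigenspace, hN, LinearMap.mem_ker]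
  constructor
  · rintro ⟨k, hk⟩
    induction k with
    | zero =>
      have : x = 0 := by simpa using hk
      rw [this, map_zero]
    | succ k ih =>
      rcases k with _ | k
      · simpa using hk
      · rw [pow_succ', Module.End.mul_apply] at hk
        obtain ⟨h1, h2⟩ := outSum_inSum_eq_zero_of_twoStepSubTwo hconn hcard hk
        refine ih (eq_zero_of_twoStepSubTwo_eq (y := (twoStepSubTwo G ^ k) x) ?_ h1 h2)
        rw [pow_succ', Module.End.mul_apply]
  · intro h
    exact ⟨1, by simpa using h⟩

variable (G)

lemma mem_ker_vertexSumMatrix (x : G.Dart → ℂ) :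
    x ∈ (vertexSumMatrix G).mulVecLin.ker ↔ outSum G x = 0 ∧ inSum G x = 0 := by
  rw [LinearMap.mem_ker, Matrix.mulVecLin_apply, funext_iff, Sum.forall, funext_iff, funext_iff]
  simp [vertexSumMatrix, Matrix.mulVec, dotProduct, outSum, inSum]

variable {G}

lemma ker_vertexSumMatrix_eq (hconn : G.Connected)
    (hcard : Fintype.card V ≠ G.edgeFinset.card) :
    (twoStepSubTwo G).ker = (vertexSumMatrix G).mulVecLin.ker := by
  ext x
  rw [mem_ker_vertexSumMatrix, LinearMap.mem_ker]
  exact ⟨outSum_inSum_eq_zero_of_twoStepSubTwo hconn hcard,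
    fun h => twoStepSubTwo_eq_zero_of_outSum_inSum h.1 h.2⟩

/-- The multiplicity of the eigenvalue `2`, in terms of the kernel of the transpose of the matrix of
vertex sums. -/
lemma rootMultiplicity_two_add (hconn : G.Connected)
    (hcard : Fintype.card V ≠ G.edgeFinset.card) :
    (relMatrix (TwoStep G)).charpoly.rootMultiplicity 2 + 2 * Fintype.card V =
      2 * G.edgeFinset.card +
        Module.finrank ℂ (vertexSumMatrix G).transpose.mulVecLin.ker := by
  -- Algebraic multiplicity is the dimension of the generalized eigenspace; rank-nullity for the
  -- vertex-sum matrix and its transpose, which have equal rank, does the rest.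
  have h1 := LinearMap.finrank_maxGenEigenspace_eq (Matrix.toLin' (relMatrix (TwoStep G))) 2
  rw [maxGenEigenspace_twoStep_eq_ker hconn hcard, ker_vertexSumMatrix_eq hconn hcard,
    Matrix.charpoly_toLin'] at h1
  have h2 := LinearMap.finrank_range_add_finrank_ker (vertexSumMatrix G).mulVecLin
  have h3 := LinearMap.finrank_range_add_finrank_ker (vertexSumMatrix G).transpose.mulVecLin
  have h4 := (vertexSumMatrix G).rank_transpose
  rw [Matrix.rank, Matrix.rank] at h4
  rw [Module.finrank_fintype_fun_eq_card, SimpleGraph.dart_card_eq_twice_card_edges] at h2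
  rw [Module.finrank_fintype_fun_eq_card, Fintype.card_sum] at h3
  omega

end EdgeMatrices

end ModifiedZeta

namespace ModifiedZeta

/-! ### Orders of meromorphic functions -/

section Meromorphic

lemma analyticAt_prod_one_sub_mul (s : Multiset ℂ) (z : ℂ) :
    AnalyticAt ℂ (fun u => (s.map fun x => 1 - u * x).prod) z := by
  induction s using Multiset.induction_on with
  | empty => simpa using analyticAt_const
  | cons x s ih =>
    have hlin : AnalyticAt ℂ (fun u : ℂ => 1 - u * x) z := by fun_prop
    simp only [Multiset.map_cons, Multiset.prod_cons]
    exact hlin.mul ih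

lemma meromorphicOrderAt_prod_one_sub_mul {a : ℂ} (ha : a ≠ 0) (s : Multiset ℂ) :
    meromorphicOrderAt (fun u => (s.map fun x => 1 - u * x).prod) a⁻¹ =
      ((s.count a : ℤ) : WithTop ℤ) := by
  have hlin : ∀ x : ℂ, AnalyticAt ℂ (fun u : ℂ => 1 - u * x) a⁻¹ := fun x => by fun_prop
  have hprod := fun s => analyticAt_prod_one_sub_mul s a⁻¹
  induction s using Multiset.induction_on with
  | empty =>
    refine (meromorphicOrderAt_eq_int_iff (hprod 0).meromorphicAt).2
      ⟨fun _ => 1, analyticAt_const, one_ne_zero, ?_⟩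
    simp
  | cons x s ih =>
    have hx : meromorphicOrderAt (fun u : ℂ => 1 - u * x) a⁻¹ =
        (((if a = x then 1 else 0 : ℕ) : ℤ) : WithTop ℤ) := by
      rw [meromorphicOrderAt_eq_int_iff (hlin x).meromorphicAt]
      split_ifs with h
      · subst h
        -- The simple zero comes from `1 - u a = (u - a⁻¹) (-a)`.
        refine ⟨fun _ => -a, analyticAt_const, neg_ne_zero.2 ha, Eventually.of_forall fun u => ?_⟩
        simp only [Nat.cast_one, zpow_one, smul_eq_mul]
        field_simp
        ring
      · refine ⟨fun u => 1 - u * x, hlin x, ?_, by simp⟩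
        intro h0
        field_simp at h0
        exact h (sub_eq_zero.1 (h0.trans (mul_zero a)))
    have hmul : (fun u : ℂ => (((x ::ₘ s).map fun x => 1 - u * x).prod)) =
        (fun u : ℂ => 1 - u * x) * fun u : ℂ => (s.map fun x => 1 - u * x).prod := by
      ext u; simp
    rw [hmul, meromorphicOrderAt_mul (hlin x).meromorphicAt (hprod s).meromorphicAt, hx, ih,
      Multiset.count_cons, ← WithTop.coe_add, add_comm]
    push_cast
    rfl

lemma meromorphic_inv_det_one_sub_smul {n : Type*} [Fintype n] [DecidableEq n]
    (A : Matrix n n ℂ) : Meromorphic fun u : ℂ => ((1 - u • A).det)⁻¹ := fun z => by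
  simp only [det_one_sub_smul_eq_prod_roots]
  exact (analyticAt_prod_one_sub_mul _ z).meromorphicAt.inv

lemma meromorphicOrderAt_inv_det_one_sub_smul {n : Type*} [Fintype n] [DecidableEq n]
    (A : Matrix n n ℂ) {a : ℂ} (ha : a ≠ 0) :
    meromorphicOrderAt (fun u : ℂ => ((1 - u • A).det)⁻¹) a⁻¹ =
      ((-(A.charpoly.rootMultiplicity a : ℤ) : ℤ) : WithTop ℤ) := by
  have h : (fun u : ℂ => ((1 - u • A).det)⁻¹) =
      (fun u : ℂ => (A.charpoly.roots.map fun x => 1 - u * x).prod)⁻¹ := by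
    ext u; simp [det_one_sub_smul_eq_prod_roots]
  rw [h, meromorphicOrderAt_inv, meromorphicOrderAt_prod_one_sub_mul ha, Polynomial.count_roots]
  rfl

/-- The identity theorem for meromorphic functions, in terms of orders. -/
lemma meromorphicOrderAt_eq_of_eventuallyEq {f g : ℂ → ℂ} (hf : Meromorphic f)
    (hg : Meromorphic g) {a : ℂ} (h : f =ᶠ[𝓝 a] g) (b : ℂ) :
    meromorphicOrderAt f b = meromorphicOrderAt g b := by
  have htop : meromorphicOrderAt (f - g) a = ⊤ := by
    rw [meromorphicOrderAt_eq_top_iff]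
    filter_upwards [h.filter_mono nhdsWithin_le_nhds] with u hu
    simp [hu]
  -- A meromorphic function on the connected plane has infinite order everywhere or nowhere.
  have hall : meromorphicOrderAt (f - g) b = ⊤ := by
    by_contra hb
    exact (hf.sub hg).exists_meromorphicOrderAt_ne_top_iff_forall.1 ⟨b, hb⟩ a htop
  refine meromorphicOrderAt_congr ?_
  filter_upwards [meromorphicOrderAt_eq_top_iff.1 hall] with u hu
  exact sub_eq_zero.1 hu

end Meromorphic

/-! ### The modified zeta function -/

section Main

variable {V : Type*} (G : SimpleGraph V)

lemma isPrimeTwoStepCycle_eq : IsPrimeTwoStepCycle G = IsPrimitiveWord (TwoStep G) := by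
  ext l
  exact isPrimitiveWord_iff.symm

/-- The Euler product converges to the inverse of a characteristic determinant. -/
lemma eventually_hasProd_eulerFactor [Fintype V] [DecidableEq V] [DecidableRel G.Adj] :
    ∀ᶠ u in 𝓝 (0 : ℂ),
      HasProd (eulerFactor G u) ((1 - u • relMatrix (TwoStep G)).det)⁻¹ := by
  filter_upwards [eventually_norm_mul_lt_one {(Fintype.card G.Dart : ℂ)},
    eventually_norm_mul_lt_one (relMatrix (TwoStep G)).charpoly.roots] with u hu hr
  have h := hasProd_primitiveClass (TwoStep G) (hu _ (Multiset.mem_singleton_self _)) hr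
  unfold eulerFactor PrimeClass
  rw [isPrimeTwoStepCycle_eq]
  exact h

end Main

end ModifiedZeta

theorem corollary3p5 {V : Type*} [Fintype V] [DecidableEq V] (G : SimpleGraph V)
    [DecidableRel G.Adj] (hconn : G.Connected) (hdeg : 3 ≤ G.minDegree) :
    -- the Euler product converges for all sufficiently small `u`
    (∀ᶠ u in 𝓝 (0 : ℂ), Multipliable (ModifiedZeta.eulerFactor G u)) ∧
    -- it has a meromorphic continuation to the complex plane
    (∃ Z : ℂ → ℂ, ModifiedZeta.IsMeromorphicContinuation (ModifiedZeta.modifiedZeta G) Z) ∧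
    -- and every such continuation has a pole of the stated order at `1 / 2`
    ∀ Z : ℂ → ℂ, ModifiedZeta.IsMeromorphicContinuation (ModifiedZeta.modifiedZeta G) Z →
      (G.IsBipartite → ModifiedZeta.HasPoleOfOrder Z (1 / 2)
        (2 * ((G.edgeFinset.card : ℤ) - (Fintype.card V : ℤ) + 1))) ∧
      (¬ G.IsBipartite → ModifiedZeta.HasPoleOfOrder Z (1 / 2)
        (2 * ((G.edgeFinset.card : ℤ) - (Fintype.card V : ℤ)) + 1)) := by
  have hprod := ModifiedZeta.eventually_hasProd_eulerFactor G
  have hmero := ModifiedZeta.meromorphic_inv_det_one_sub_smul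
    (ModifiedZeta.relMatrix (ModifiedZeta.TwoStep G))
  have hzeta : ∀ᶠ u in 𝓝 (0 : ℂ), ModifiedZeta.modifiedZeta G u =
      ((1 - u • ModifiedZeta.relMatrix (ModifiedZeta.TwoStep G)).det)⁻¹ :=
    hprod.mono fun u hu => hu.tprod_eq
  have hlt := ModifiedZeta.card_lt_card_edgeFinset hconn hdeg
  have hmult := ModifiedZeta.rootMultiplicity_two_add hconn hlt.ne
  refine ⟨hprod.mono fun u hu => hu.multipliable,
    ⟨_, hmero, hzeta.mono fun u hu => hu.symm⟩, fun Z hZ => ?_⟩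
  -- Any continuation agrees near `0` with the inverse determinant, hence has the same order at
  -- every point, whatever values it takes at its poles.
  have horder : meromorphicOrderAt Z (1 / 2) = ((-((ModifiedZeta.relMatrix
      (ModifiedZeta.TwoStep G)).charpoly.rootMultiplicity 2 : ℤ) : ℤ) : WithTop ℤ) := by
    rw [← ModifiedZeta.meromorphicOrderAt_inv_det_one_sub_smul _ two_ne_zero, one_div]
    exact ModifiedZeta.meromorphicOrderAt_eq_of_eventuallyEq hZ.1 hmero
      (by filter_upwards [hZ.2, hzeta] with u h1 h2 using h1.trans h2) _
  have hpole : ∀ k : ℤ, 0 < k → k = ((ModifiedZeta.relMatrix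
      (ModifiedZeta.TwoStep G)).charpoly.rootMultiplicity 2 : ℤ) →
      ModifiedZeta.HasPoleOfOrder Z (1 / 2) k := by
    rintro k hk rfl
    exact ⟨hZ.1 _, hk, horder⟩
  refine ⟨fun hb => hpole _ (by omega) ?_, fun hb => hpole _ (by omega) ?_⟩
  · rw [ModifiedZeta.finrank_ker_vertexSumMatrix_transpose_of_isBipartite hconn hb] at hmult
    omega
  · rw [ModifiedZeta.finrank_ker_vertexSumMatrix_transpose_of_not_isBipartite hconn hb] at hmult
    omega
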